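/- **Theorem (Equivalence of base measures).** Let $\mathsf G$ be a real Lie group of finite dimension $m\ge 0$ (a smooth manifold without boundary, Hausdorff and second countable, with smooth group operations; neither compactness nor connectedness is assumed), with identity $e$ and Lie algebra $\mathfrak g=T_e\mathsf G$, and let $\langle\cdot,\cdot\rangle$ be an arbitrary inner product on $\mathfrak g$. For $g\in\mathsf G$ let $T_gL_{g^{-1}}:T_g\mathsf G\to\mathfrak g$ be the tangent map at $g$ of the left translation $L_{g^{-1}}:x\mapsto g^{-1}x$. On the $2m$-dimensional manifold $\mathsf G\times\mathfrak g\cong T\mathsf G$ let $\omega$ be the symplectic $2$-form $$\omega_{(g,\mu)}\big((v,\alpha),(w,\beta)\big)=\langle\beta,T_gL_{g^{-1}}v\rangle-\langle\alpha,T_gL_{g^{-1}}w\rangle+\big\langle\mu,[T_gL_{g^{-1}}v,\,T_gL_{g^{-1}}w]\big\rangle,$$ where $(g,\mu)\in\mathsf G\times\mathfrak g$, $v,w\in T_g\mathsf G$ and $\alpha,\beta\in\mathfrak g$, and let $\omega^m=\omega\wedge\dots\wedge\omega$ ($m$ factors; $\omega^0=1$). Then there is exactly one Borel measure $|\omega^m|$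 on $\mathsf G\times\mathfrak g$ induced by $\omega^m$, that is, a measure which in every smooth chart with coordinates $y^1,\dots,y^{2m}$ has the density $\big|\omega^m(\partial/\partial y^1,\dots,\partial/\partial y^{2m})\big|$ with respect to $\mathrm dy^1\cdots \mathrm dy^{2m}$. Moreover, for every left Haar measure $\mathrm dg$ on $\mathsf G$ and every Lebesgue measure (nonzero translation-invariant Borel measure, finite on compact sets) $\mathrm d\xi$ on $\mathfrak g$, there is a constant $c\in(0,\infty)$ such that $$\mathrm dg\otimes \mathrm d\xi=c\,|\omega^m| .$$ -/

import Mathlib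

open MeasureTheory
open scoped Manifold ContDiff NNReal ENNReal

noncomputable section

namespace LieVolume

/-! ### Exterior algebra of alternating forms -/

section Wedge

variable {V : Type*} [AddCommGroup V] [Module ℝ V]

/-- The exterior product of two real-valued alternating forms (sum over shuffles). -/
def wedge {p q : ℕ} (a : V [⋀^Fin p]→ₗ[ℝ] ℝ) (b : V [⋀^Fin q]→ₗ[ℝ] ℝ) :
    V [⋀^Fin (p + q)]→ₗ[ℝ] ℝ :=
  ((LinearMap.mul' ℝ ℝ).compAlternatingMap (a.domCoprod b)).domDomCongr finSumFinEquiv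

/-- The `k`-fold exterior power `a ∧ ⋯ ∧ a` of a `2`-form `a`. -/
def wedgePow (a : V [⋀^Fin 2]→ₗ[ℝ] ℝ) : (k : ℕ) → V [⋀^Fin (2 * k)]→ₗ[ℝ] ℝ
  | 0 => AlternatingMap.constOfIsEmpty ℝ V (Fin 0) 1
  | k + 1 => wedge (wedgePow a k) a

end Wedge

/-! ### The measure induced by a top-degree form on a manifold -/

/-- `μ` is the (Borel) measure `|Ω|` induced by the top-degree form `Ω` on the manifold `M` without
boundary: on the domain of every chart `φ` of the smooth structure, and with respect to every basis
`b` of the model space (linear coordinates `y¹, …, yⁿ`), it has density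
`|Ω (∂/∂y¹, …, ∂/∂yⁿ)|` with respect to `dy¹ ⋯ dyⁿ`. -/
def IsFormMeasure {n : ℕ} {V : Type*} [NormedAddCommGroup V] [NormedSpace ℝ V]
    [MeasurableSpace V] [BorelSpace V] {H : Type*} [TopologicalSpace H]
    (J : ModelWithCorners ℝ V H) {M : Type*} [TopologicalSpace M] [ChartedSpace H M]
    [MeasurableSpace M] (Ω : (x : M) → TangentSpace J x [⋀^Fin n]→ₗ[ℝ] ℝ) (μ : Measure M) : Prop :=
  ∀ φ ∈ IsManifold.maximalAtlas J ∞ M, ∀ b : Module.Basis (Fin n) ℝ V,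
    ∀ A : Set M, MeasurableSet A → A ⊆ φ.source →
      μ A = ∫⁻ y in φ.extend J '' A,
        ENNReal.ofReal |Ω ((φ.extend J).symm y)
          (fun i => mfderiv 𝓘(ℝ, V) J (φ.extend J).symm y (b i))| ∂b.addHaar

/-! ### The Lie algebra as a finite-dimensional normed space

In Mathlib the Lie algebra `𝔤 = T_e G` has as underlying topological vector space the model space.
It is given the norm and the Borel sets of the model space; the norm plays no role below except to
define the (norm-independent) smooth structure of the vector space `𝔤`. -/

section LieAlgebra

variable {m : ℕ} {G : Type*} [TopologicalSpace G] [ChartedSpace (EuclideanSpace ℝ (Fin m)) G]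
  [Group G]

instance : NormedAddCommGroup (GroupLieAlgebra (𝓡 m) G) :=
  inferInstanceAs (NormedAddCommGroup (EuclideanSpace ℝ (Fin m)))

instance : NormedSpace ℝ (GroupLieAlgebra (𝓡 m) G) :=
  inferInstanceAs (NormedSpace ℝ (EuclideanSpace ℝ (Fin m)))

instance : FiniteDimensional ℝ (GroupLieAlgebra (𝓡 m) G) :=
  inferInstanceAs (FiniteDimensional ℝ (EuclideanSpace ℝ (Fin m)))

instance : MeasurableSpace (GroupLieAlgebra (𝓡 m) G) :=
  inferInstanceAs (MeasurableSpace (EuclideanSpace ℝ (Fin m)))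

instance : BorelSpace (GroupLieAlgebra (𝓡 m) G) :=
  inferInstanceAs (BorelSpace (EuclideanSpace ℝ (Fin m)))

instance [LieGroup (𝓡 m) ∞ G] : LieGroup (𝓡 m) (minSmoothness ℝ 3) G := by
  rw [minSmoothness_of_isRCLikeNormedField]; infer_instance

end LieAlgebra

/-! ### The symplectic form in the left trivialization -/

section Trivialized

variable {L : Type*} [LieRing L] [LieAlgebra ℝ L]

lemma core_add_right (ip : InnerProductSpace.Core ℝ L) (x y z : L) :
    ip.inner x (y + z) = ip.inner x y + ip.inner x z := by
  rw [← ip.conj_inner_symm, ip.add_left, map_add, ip.conj_inner_symm, ip.conj_inner_symm]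

lemma core_smul_right (ip : InnerProductSpace.Core ℝ L) (r : ℝ) (x y : L) :
    ip.inner x (r • y) = r * ip.inner x y := by
  rw [← ip.conj_inner_symm, ip.smul_left, map_mul, ip.conj_inner_symm]
  simp

/-- The alternating `2`-form `((ξ, α), (η, β)) ↦ ⟨β, ξ⟩ - ⟨α, η⟩ + ⟨μ, [ξ, η]⟩` on `L × L`, where
`L` is a real Lie algebra with an inner product and `μ ∈ L`. -/
def trivializedForm (ip : InnerProductSpace.Core ℝ L) (μ : L) : (L × L) [⋀^Fin 2]→ₗ[ℝ] ℝ where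
  toFun u :=
    ip.inner (u 1).2 (u 0).1 - ip.inner (u 0).2 (u 1).1 + ip.inner μ ⁅(u 0).1, (u 1).1⁆
  map_update_add' := by
    intro _ u i x y
    fin_cases i <;>
      simp [Function.update, core_add_right, ip.add_left] <;> ring
  map_update_smul' := by
    intro _ u i r x
    fin_cases i <;>
      simp [Function.update, core_smul_right, ip.smul_left] <;> ring
  map_eq_zero_of_eq' := by
    intro u i j h hij
    have h01 : u 0 = u 1 := by
      fin_cases i <;> fin_cases j <;> simp_all
    have h0 : ip.inner μ 0 = 0 := by simpa using core_smul_right ip 0 μ 0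
    simp [h01, h0]

end Trivialized

/-! ### The symplectic form on `G × 𝔤` -/

section Symplectic

variable {m : ℕ} {G : Type*} [TopologicalSpace G] [ChartedSpace (EuclideanSpace ℝ (Fin m)) G]
  [Group G] [LieGroup (𝓡 m) ∞ G]

/-- Left trivialization: the tangent map `T_g L_{g⁻¹} : T_g G → T_e G = 𝔤`. -/
def leftTriv (g : G) : TangentSpace (𝓡 m) g →L[ℝ] GroupLieAlgebra (𝓡 m) G :=
  mfderiv (𝓡 m) (𝓡 m) (fun x : G => g⁻¹ * x) g

/-- Left trivialization of the tangent space of `G × 𝔤` at `p = (g, μ)`: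
`(v, α) ↦ (T_g L_{g⁻¹} v, α)`. -/
def leftTrivProd (p : G × GroupLieAlgebra (𝓡 m) G) :
    TangentSpace ((𝓡 m).prod 𝓘(ℝ, GroupLieAlgebra (𝓡 m) G)) p →ₗ[ℝ]
      GroupLieAlgebra (𝓡 m) G × GroupLieAlgebra (𝓡 m) G :=
  (leftTriv p.1).toLinearMap.prodMap
    (LinearMap.id : GroupLieAlgebra (𝓡 m) G →ₗ[ℝ] GroupLieAlgebra (𝓡 m) G)

/-- The symplectic `2`-form on `G × 𝔤` associated with the inner product `ip` on `𝔤`: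
`ω_{(g,μ)}((v,α),(w,β)) = ⟨β, T_g L_{g⁻¹} v⟩ - ⟨α, T_g L_{g⁻¹} w⟩
  + ⟨μ, [T_g L_{g⁻¹} v, T_g L_{g⁻¹} w]⟩`. -/
def symplecticForm (ip : InnerProductSpace.Core ℝ (GroupLieAlgebra (𝓡 m) G))
    (p : G × GroupLieAlgebra (𝓡 m) G) :
    TangentSpace ((𝓡 m).prod 𝓘(ℝ, GroupLieAlgebra (𝓡 m) G)) p [⋀^Fin 2]→ₗ[ℝ] ℝ :=
  (trivializedForm ip p.2).compLinearMap (leftTrivProd p)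

end Symplectic

end LieVolume

end

/-!
Left translations of `G` and translations of `𝔤` turn `G × 𝔤` into a Lie group, and in the left
trivialization `ω` depends on the base point `(g, μ)` only through the curvature term
`⟨μ, [ξ, η]⟩`. This term is absorbed by a shear `(ξ, α) ↦ (ξ, α + T ξ)`, which has determinant `1`,
so that `|ω^m|` does not depend on `μ` either: it is invariant under left translations. It is not
zero because `ω` has a Darboux basis at `μ = 0`.

By the change of variables formula the chart measures of a top-degree form agree on overlaps and
glue to a unique measure `|ω^m|`, which inherits the invariance. The invariance also makes its
density near the identity the product of a nonzero constant and a continuous Jacobian that is `1`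
at the identity. So `|ω^m|` is a Haar measure on `G × 𝔤`, as is `dg ⊗ dξ`, and Haar measures are
proportional.
-/

noncomputable section

namespace LieVolume

/-! ### Powers of a form with a Darboux family -/

section Wedge

variable {V W : Type*} [AddCommGroup V] [Module ℝ V] [AddCommGroup W] [Module ℝ W]

/-- The term of the permutation `σ` in the expansion of `p! q! (a ∧ b)` as a sum over all
permutations of the `p + q` arguments. -/
def wedgeTerm {p q : ℕ} (a : V [⋀^Fin p]→ₗ[ℝ] ℝ) (b : V [⋀^Fin q]→ₗ[ℝ] ℝ)
    (w : Fin p ⊕ Fin q → V) (σ : Equiv.Perm (Fin p ⊕ Fin q)) : ℝ :=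
  (Equiv.Perm.sign σ : ℤ) * (a (w ∘ σ ∘ Sum.inl) * b (w ∘ σ ∘ Sum.inr))

lemma factorial_mul_wedge_apply {p q : ℕ} (a : V [⋀^Fin p]→ₗ[ℝ] ℝ) (b : V [⋀^Fin q]→ₗ[ℝ] ℝ)
    (v : Fin (p + q) → V) :
    ((p.factorial * q.factorial : ℕ) : ℝ) * wedge a b v =
      ∑ σ, wedgeTerm a b (v ∘ finSumFinEquiv) σ := by
  have h := congrArg (fun f => LinearMap.mul' ℝ ℝ (f (v ∘ finSumFinEquiv)))
    (MultilinearMap.domCoprod_alternization_eq a b)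
  simp only [Fintype.card_fin, AlternatingMap.smul_apply, map_nsmul,
    MultilinearMap.alternatization_apply, map_sum] at h
  rw [nsmul_eq_mul] at h
  refine h.symm.trans (Finset.sum_congr rfl fun σ _ => ?_)
  rw [Units.smul_def, map_zsmul, zsmul_eq_mul]
  rfl

lemma wedge_compLinearMap {p q : ℕ} (a : V [⋀^Fin p]→ₗ[ℝ] ℝ) (b : V [⋀^Fin q]→ₗ[ℝ] ℝ)
    (f : W →ₗ[ℝ] V) :
    wedge (a.compLinearMap f) (b.compLinearMap f) = (wedge a b).compLinearMap f := by
  ext v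
  have hpq : ((p.factorial * q.factorial : ℕ) : ℝ) ≠ 0 := by positivity
  refine mul_left_cancel₀ hpq ?_
  rw [AlternatingMap.compLinearMap_apply, factorial_mul_wedge_apply, factorial_mul_wedge_apply]
  rfl

lemma wedgePow_compLinearMap (a : V [⋀^Fin 2]→ₗ[ℝ] ℝ) (f : W →ₗ[ℝ] V) (k : ℕ) :
    wedgePow (a.compLinearMap f) k = (wedgePow a k).compLinearMap f := by
  induction k with
  | zero => rfl
  | succ k ih => rw [wedgePow, ih, wedge_compLinearMap, wedgePow]

lemma wedgeTerm_mul {p q : ℕ} (a : V [⋀^Fin p]→ₗ[ℝ] ℝ) (b : V [⋀^Fin q]→ₗ[ℝ] ℝ)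
    (w : Fin p ⊕ Fin q → V) (π σ : Equiv.Perm (Fin p ⊕ Fin q)) :
    wedgeTerm a b w (π * σ) = (Equiv.Perm.sign π : ℤ) * wedgeTerm a b (w ∘ π) σ := by
  simp only [wedgeTerm, Equiv.Perm.sign_mul, Units.val_mul, Int.cast_mul, mul_assoc]
  rfl

lemma wedgeTerm_sumCongr {p q : ℕ} (a : V [⋀^Fin p]→ₗ[ℝ] ℝ) (b : V [⋀^Fin q]→ₗ[ℝ] ℝ)
    (w : Fin p ⊕ Fin q → V) (ρ : Equiv.Perm (Fin p)) (τ : Equiv.Perm (Fin q)) :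
    wedgeTerm a b w (Equiv.Perm.sumCongr ρ τ) = a (w ∘ Sum.inl) * b (w ∘ Sum.inr) := by
  have hρ := a.map_perm (w ∘ Sum.inl) ρ
  have hτ := b.map_perm (w ∘ Sum.inr) τ
  change _ * (a ((w ∘ Sum.inl) ∘ ρ) * b ((w ∘ Sum.inr) ∘ τ)) = _
  rw [hρ, hτ, Equiv.Perm.sign_sumCongr]
  rcases Int.units_eq_one_or (Equiv.Perm.sign ρ) with hρ' | hρ' <;>
    rcases Int.units_eq_one_or (Equiv.Perm.sign τ) with hτ' | hτ' <;> simp [hρ', hτ']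

/-- The matrix of the standard symplectic form in a basis `x₀, y₀, x₁, y₁, …`. -/
def stdSymplectic (i j : ℕ) : ℝ :=
  if i % 2 = 0 ∧ j = i + 1 then 1 else if j % 2 = 0 ∧ i = j + 1 then -1 else 0

lemma stdSymplectic_ne_zero {i j : ℕ} (h : stdSymplectic i j ≠ 0) :
    ∃ l, (i = 2 * l ∧ j = 2 * l + 1) ∨ (i = 2 * l + 1 ∧ j = 2 * l) := by
  unfold stdSymplectic at h
  split_ifs at h with hij hji
  · exact ⟨i / 2, by omega⟩
  · exact ⟨j / 2, by omega⟩
  · exact absurd rfl h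

/-- The permutation that exchanges the `l`-th and the last of the pairs
`{0, 1}, {2, 3}, …, {2k, 2k + 1}`. -/
def pairSwap (k : ℕ) (l : Fin (k + 1)) : Equiv.Perm (Fin (2 * k + 2)) :=
  Equiv.swap ⟨2 * l, by omega⟩ ⟨2 * k, by omega⟩ *
    Equiv.swap ⟨2 * l + 1, by omega⟩ ⟨2 * k + 1, by omega⟩

lemma sign_pairSwap (k : ℕ) (l : Fin (k + 1)) : Equiv.Perm.sign (pairSwap k l) = 1 := by
  by_cases h : (l : ℕ) = k
  · simp [pairSwap, h]
  · rw [pairSwap, Equiv.Perm.sign_mul, Equiv.Perm.sign_swap, Equiv.Perm.sign_swap] <;> simp [h]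

lemma pairSwap_val (k : ℕ) (l : Fin (k + 1)) (i : Fin (2 * k + 2)) :
    (pairSwap k l i : ℕ) =
      if (i : ℕ) = 2 * l then 2 * k
      else if (i : ℕ) = 2 * l + 1 then 2 * k + 1
      else if (i : ℕ) = 2 * k then 2 * l
      else if (i : ℕ) = 2 * k + 1 then 2 * (l : ℕ) + 1
      else i := by
  simp only [pairSwap, Equiv.Perm.mul_apply, Equiv.swap_apply_def, Fin.ext_iff]
  split_ifs <;> simp_all <;> omega

lemma pairSwap_pairSwap (k : ℕ) (l : Fin (k + 1)) (i : Fin (2 * k + 2)) :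
    pairSwap k l (pairSwap k l i) = i := by
  apply Fin.ext
  have hi := pairSwap_val k l i
  have hii := pairSwap_val k l (pairSwap k l i)
  split_ifs at hi hii <;> omega

lemma stdSymplectic_pairSwap (k : ℕ) (l : Fin (k + 1)) (i j : Fin (2 * k + 2)) :
    stdSymplectic (pairSwap k l i) (pairSwap k l j) = stdSymplectic i j := by
  have hi := pairSwap_val k l i
  have hj := pairSwap_val k l j
  unfold stdSymplectic
  congr 1
  · apply propext; split_ifs at hi hj <;> omega
  · congr 1
    apply propext; split_ifs at hi hj <;> omega

lemma exists_eq_pairSwap_mul_sumCongr {k : ℕ} (σ : Equiv.Perm (Fin (2 * k) ⊕ Fin 2))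
    (h : stdSymplectic (finSumFinEquiv (σ (Sum.inr 0))) (finSumFinEquiv (σ (Sum.inr 1))) ≠ 0) :
    ∃ l ρ τ, σ = finSumFinEquiv.symm.permCongr (pairSwap k l) * Equiv.Perm.sumCongr ρ τ := by
  obtain ⟨l, hl⟩ := stdSymplectic_ne_zero h
  have hlk : l < k + 1 := by omega
  set π : Equiv.Perm (Fin (2 * k) ⊕ Fin 2) := finSumFinEquiv.symm.permCongr (pairSwap k ⟨l, hlk⟩)
  have hππ : π * π = 1 := by ext x; simp [π, pairSwap_pairSwap]
  have hlast (t : Fin 2) : 2 * k ≤ pairSwap k ⟨l, hlk⟩ (finSumFinEquiv (σ (Sum.inr t))) := by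
    rw [pairSwap_val]
    fin_cases t <;> simp only [Fin.zero_eta, Fin.mk_one] <;> split_ifs <;> omega
  have hinr : Set.MapsTo (π * σ) (Set.range Sum.inr) (Set.range Sum.inr) := by
    rintro _ ⟨t, rfl⟩
    refine ⟨⟨pairSwap k ⟨l, hlk⟩ (finSumFinEquiv (σ (Sum.inr t))) - 2 * k, by omega⟩, ?_⟩
    have := hlast t
    rw [Equiv.Perm.mul_apply, Equiv.permCongr_apply, Equiv.symm_symm, Equiv.eq_symm_apply]
    ext
    simp only [finSumFinEquiv_apply_right, Fin.val_natAdd]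
    omega
  obtain ⟨⟨ρ, τ⟩, hρτ⟩ := Equiv.Perm.mem_sumCongrHom_range_of_perm_mapsTo_inl
    ((Equiv.Perm.perm_mapsTo_inl_iff_mapsTo_inr _).2 hinr)
  refine ⟨⟨l, hlk⟩, ρ, τ, ?_⟩
  change Equiv.Perm.sumCongr ρ τ = π * σ at hρτ
  rw [hρτ, ← mul_assoc, hππ, one_mul]

/-- `v` is a Darboux family `x₀, y₀, x₁, y₁, …` of the `2`-form `a`. -/
def IsDarboux (a : V [⋀^Fin 2]→ₗ[ℝ] ℝ) {n : ℕ} (v : Fin n → V) : Prop :=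
  ∀ i j, a ![v i, v j] = stdSymplectic i j

lemma IsDarboux.comp_pairSwap {a : V [⋀^Fin 2]→ₗ[ℝ] ℝ} {k : ℕ} {v : Fin (2 * k + 2) → V}
    (hv : IsDarboux a v) (l : Fin (k + 1)) : IsDarboux a (v ∘ pairSwap k l) :=
  fun i j => (hv _ _).trans (stdSymplectic_pairSwap k l i j)

lemma IsDarboux.wedgeTerm_sumCongr_pos {a : V [⋀^Fin 2]→ₗ[ℝ] ℝ} {k : ℕ}
    (ha : ∀ v, IsDarboux a v → 0 < wedgePow a k v) {v : Fin (2 * k + 2) → V}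
    (hv : IsDarboux a v) (ρ : Equiv.Perm (Fin (2 * k))) (τ : Equiv.Perm (Fin 2)) :
    0 < wedgeTerm (wedgePow a k) a (v ∘ finSumFinEquiv) (Equiv.Perm.sumCongr ρ τ) := by
  have hinl : IsDarboux a ((v ∘ finSumFinEquiv) ∘ Sum.inl) := fun i j => by
    simpa using hv (Fin.castAdd 2 i) (Fin.castAdd 2 j)
  have hinr : (v ∘ finSumFinEquiv) ∘ Sum.inr = ![v (Fin.natAdd (2 * k) 0), v (Fin.natAdd _ 1)] := by
    ext i; fin_cases i <;> rfl
  have hlast : a ((v ∘ finSumFinEquiv) ∘ Sum.inr) = 1 := by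
    rw [hinr, hv]; simp [stdSymplectic]
  rw [wedgeTerm_sumCongr, hlast, mul_one]
  exact ha _ hinl

lemma IsDarboux.wedgeTerm_nonneg {a : V [⋀^Fin 2]→ₗ[ℝ] ℝ} {k : ℕ}
    (ha : ∀ v, IsDarboux a v → 0 < wedgePow a k v) {v : Fin (2 * k + 2) → V}
    (hv : IsDarboux a v) (σ : Equiv.Perm (Fin (2 * k) ⊕ Fin 2)) :
    0 ≤ wedgeTerm (wedgePow a k) a (v ∘ finSumFinEquiv) σ := by
  by_cases h0 : a ((v ∘ finSumFinEquiv) ∘ σ ∘ Sum.inr) = 0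
  · simp [wedgeTerm, h0]
  have hinr : (v ∘ finSumFinEquiv) ∘ σ ∘ Sum.inr =
      ![v (finSumFinEquiv (σ (Sum.inr 0))), v (finSumFinEquiv (σ (Sum.inr 1)))] := by
    ext i; fin_cases i <;> rfl
  rw [hinr, hv] at h0
  -- `σ` sends the last two arguments to one Darboux pair, and permutations of whole pairs are even,
  -- so this may be taken to be the last pair.
  obtain ⟨l, ρ, τ, rfl⟩ := exists_eq_pairSwap_mul_sumCongr σ h0
  have hcomp : (v ∘ finSumFinEquiv) ∘ finSumFinEquiv.symm.permCongr (pairSwap k l) =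
      (v ∘ pairSwap k l) ∘ finSumFinEquiv := by
    ext x; simp
  rw [wedgeTerm_mul, Equiv.Perm.sign_permCongr, sign_pairSwap, hcomp]
  simpa using ((hv.comp_pairSwap l).wedgeTerm_sumCongr_pos ha ρ τ).le

theorem IsDarboux.wedgePow_pos {a : V [⋀^Fin 2]→ₗ[ℝ] ℝ} {k : ℕ} {v : Fin (2 * k) → V}
    (hv : IsDarboux a v) : 0 < wedgePow a k v := by
  induction k with
  | zero => simp [wedgePow]
  | succ k ih =>
    have hpos : 0 < ((2 * k).factorial * Nat.factorial 2 : ℕ) * wedge (wedgePow a k) a v := by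
      rw [factorial_mul_wedge_apply]
      refine Finset.sum_pos' (fun σ _ => hv.wedgeTerm_nonneg (fun _ => ih) σ)
        ⟨Equiv.Perm.sumCongr 1 1, Finset.mem_univ _, hv.wedgeTerm_sumCongr_pos (fun _ => ih) 1 1⟩
    exact pos_of_mul_pos_right hpos (Nat.cast_nonneg _)

end Wedge

/-! ### Determinants and the trivialized form -/

section Determinant

lemma alternatingMap_linearMap_comp {R M ι : Type*} [CommRing R] [AddCommGroup M] [Module R M]
    [Finite ι] (b : Module.Basis ι R M) (a : M [⋀^ι]→ₗ[R] R) (f : M →ₗ[R] M) (v : ι → M) :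
    a (f ∘ v) = LinearMap.det f * a v := by
  classical
  have := Fintype.ofFinite ι
  rw [a.eq_smul_basis_det b, AlternatingMap.smul_apply, AlternatingMap.smul_apply,
    Module.Basis.det_comp, smul_eq_mul, smul_eq_mul, mul_left_comm]

lemma abs_det_skewProd {R M N : Type*} [CommRing R] [LinearOrder R] [IsStrictOrderedRing R]
    [AddCommGroup M] [Module R M] [AddCommGroup N] [Module R N] (f : M →ₗ[R] N) :
    |LinearMap.det ((LinearEquiv.refl R M).skewProd (LinearEquiv.refl R N) f).toLinearMap| = 1 := by
  -- The reflection `D : (x, y) ↦ (x, -y)` conjugates the shear `S` into its inverse.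
  set S := ((LinearEquiv.refl R M).skewProd (LinearEquiv.refl R N) f).toLinearMap
  set D : M × N →ₗ[R] M × N := LinearMap.id.prodMap (-LinearMap.id)
  have hDD : D ∘ₗ D = LinearMap.id := by ext x <;> simp [D]
  have hDSDS : (D ∘ₗ S ∘ₗ D) ∘ₗ S = LinearMap.id := by ext x <;> simp [D, S]
  have hDD_det := congrArg LinearMap.det hDD
  have hDSDS_det := congrArg LinearMap.det hDSDS
  simp only [LinearMap.det_comp, LinearMap.det_id] at hDD_det hDSDS_det
  have hSS_det : LinearMap.det S * LinearMap.det S = 1 := by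
    linear_combination hDSDS_det - LinearMap.det S * LinearMap.det S * hDD_det
  rcases mul_self_eq_one_iff.mp hSS_det with h | h <;> simp [h]

end Determinant

section Trivialized

variable {L : Type*} [LieRing L] [LieAlgebra ℝ L]

/-- The inner product `ip` as a bilinear form. -/
def coreBilin (ip : InnerProductSpace.Core ℝ L) : LinearMap.BilinForm ℝ L :=
  LinearMap.mk₂ ℝ ip.inner ip.add_left (fun r x y => by simpa using ip.smul_left x y r)
    (core_add_right ip) (core_smul_right ip)

lemma isSymm_coreBilin (ip : InnerProductSpace.Core ℝ L) : (coreBilin ip).IsSymm :=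
  ⟨fun x y => (ip.conj_inner_symm y x :)⟩

lemma nondegenerate_coreBilin (ip : InnerProductSpace.Core ℝ L) : (coreBilin ip).Nondegenerate :=
  (isSymm_coreBilin ip).isRefl.nondegenerate_iff_separatingLeft.2
    fun x hx => ip.definite x (hx x)

lemma trivializedForm_apply (ip : InnerProductSpace.Core ℝ L) (μ : L) (u : Fin 2 → L × L) :
    trivializedForm ip μ u = coreBilin ip (u 1).2 (u 0).1 - coreBilin ip (u 0).2 (u 1).1
      + coreBilin ip μ ⁅(u 0).1, (u 1).1⁆ :=
  rfl

/-- The family `(b₀, 0), (0, b⁰), (b₁, 0), (0, b¹), …` of `L × L`, where `bⁱ` is the basis of `L`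
dual to `bᵢ` with respect to `ip`. -/
def darbouxFamily (ip : InnerProductSpace.Core ℝ L) {m : ℕ} (b : Module.Basis (Fin m) ℝ L)
    (i : Fin (2 * m)) : L × L :=
  if (i : ℕ) % 2 = 0 then (b ⟨i / 2, by omega⟩, 0)
  else (0, LinearMap.BilinForm.dualBasis (coreBilin ip) (nondegenerate_coreBilin ip) b
    ⟨i / 2, by omega⟩)

lemma isDarboux_darbouxFamily (ip : InnerProductSpace.Core ℝ L) {m : ℕ}
    (b : Module.Basis (Fin m) ℝ L) : IsDarboux (trivializedForm ip 0) (darbouxFamily ip b) := by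
  intro i j
  rw [trivializedForm_apply]
  by_cases hi : (i : ℕ) % 2 = 0 <;> by_cases hj : (j : ℕ) % 2 = 0 <;>
    simp only [Matrix.cons_val_zero, Matrix.cons_val_one, darbouxFamily, hi, hj, if_true, if_false,
      map_zero, LinearMap.zero_apply, LinearMap.BilinForm.apply_dualBasis_left, Fin.mk.injEq,
      sub_zero, zero_sub, add_zero, stdSymplectic, true_and, false_and] <;>
    split_ifs <;> first | omega | simp

variable [FiniteDimensional ℝ L]

/-- The endomorphism `T` of `L` with `⟨T ξ, η⟩ = -½ ⟨μ, [ξ, η]⟩`. -/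
def halfCoadjoint (ip : InnerProductSpace.Core ℝ L) (μ : L) : L →ₗ[ℝ] L :=
  LinearMap.BilinForm.symmCompOfNondegenerate
    (-(1 / 2 : ℝ) • (LinearMap.mk₂ ℝ (fun ξ η : L => ⁅ξ, η⁆) add_lie smul_lie lie_add
      (fun r ξ η => lie_smul r ξ η)).compr₂ (coreBilin ip μ))
    (coreBilin ip) (nondegenerate_coreBilin ip)

lemma coreBilin_halfCoadjoint (ip : InnerProductSpace.Core ℝ L) (μ ξ η : L) :
    coreBilin ip (halfCoadjoint ip μ ξ) η = -(1 / 2) * coreBilin ip μ ⁅ξ, η⁆ :=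
  LinearMap.BilinForm.symmCompOfNondegenerate_left_apply _ _ _ _

/-- The shear `(ξ, α) ↦ (ξ, α + T ξ)` that absorbs the curvature term of `trivializedForm ip μ`. -/
def curvatureShear (ip : InnerProductSpace.Core ℝ L) (μ : L) : (L × L) ≃ₗ[ℝ] L × L :=
  (LinearEquiv.refl ℝ L).skewProd (LinearEquiv.refl ℝ L) (halfCoadjoint ip μ)

lemma trivializedForm_eq_compLinearMap_curvatureShear (ip : InnerProductSpace.Core ℝ L) (μ : L) :
    trivializedForm ip μ = (trivializedForm ip 0).compLinearMap (curvatureShear ip μ) := by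
  ext u
  simp only [AlternatingMap.compLinearMap_apply, LinearEquiv.coe_coe, trivializedForm_apply,
    curvatureShear, LinearEquiv.skewProd_apply, LinearEquiv.refl_apply, map_add, map_zero,
    LinearMap.add_apply, LinearMap.zero_apply, coreBilin_halfCoadjoint]
  rw [← lie_skew (u 0).1 (u 1).1, map_neg]
  ring

lemma abs_wedgePow_trivializedForm (ip : InnerProductSpace.Core ℝ L) (μ : L) {m : ℕ}
    (hm : Module.finrank ℝ L = m) (v : Fin (2 * m) → L × L) :
    |wedgePow (trivializedForm ip μ) m v| = |wedgePow (trivializedForm ip 0) m v| := by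
  have b : Module.Basis (Fin (2 * m)) ℝ (L × L) :=
    Module.finBasisOfFinrankEq ℝ (L × L) (by rw [Module.finrank_prod, hm, two_mul])
  rw [trivializedForm_eq_compLinearMap_curvatureShear, wedgePow_compLinearMap]
  change |wedgePow (trivializedForm ip 0) m ((curvatureShear ip μ).toLinearMap ∘ v)| = _
  rw [alternatingMap_linearMap_comp b, abs_mul, curvatureShear, abs_det_skewProd, one_mul]

lemma wedgePow_trivializedForm_ne_zero (ip : InnerProductSpace.Core ℝ L) {m : ℕ}
    (hm : Module.finrank ℝ L = m) : wedgePow (trivializedForm ip 0) m ≠ 0 := fun h => by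
  have hpos := (isDarboux_darbouxFamily ip (Module.finBasisOfFinrankEq ℝ L hm)).wedgePow_pos
  simp [h] at hpos

end Trivialized

/-! ### Existence and uniqueness of the form measure -/

section MeasureGluing

lemma measure_ext_of_nhds {M : Type*} [TopologicalSpace M] [SecondCountableTopology M]
    [MeasurableSpace M] [OpensMeasurableSpace M] {μ ν : Measure M}
    (h : ∀ x, ∃ U : Set M, IsOpen U ∧ x ∈ U ∧ ∀ A, MeasurableSet A → A ⊆ U → μ A = ν A) :
    μ = ν := by
  choose U hUo hxU hU using h
  obtain ⟨s, hs, hsU⟩ := TopologicalSpace.countable_cover_nhds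
    (f := U) (fun x => (hUo x).mem_nhds (hxU x))
  refine Measure.ext_of_biUnion_eq_univ hs hsU fun x _ => Measure.ext fun A hA => ?_
  rw [Measure.restrict_apply hA, Measure.restrict_apply hA]
  exact hU x _ (hA.inter (hUo x).measurableSet) Set.inter_subset_right

lemma exists_measure_of_forall_eq_on_inter {M ι : Type*} [MeasurableSpace M] [Countable ι]
    {U : ι → Set M} (hU : ∀ i, MeasurableSet (U i)) (hcover : ⋃ i, U i = Set.univ)
    {μ : ι → Measure M}
    (hμ : ∀ i j A, MeasurableSet A → A ⊆ U i → A ⊆ U j → μ i A = μ j A) :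
    ∃ ν : Measure M, ∀ i A, MeasurableSet A → A ⊆ U i → ν A = μ i A := by
  cases isEmpty_or_nonempty ι
  · exact ⟨0, isEmptyElim⟩
  obtain ⟨f, hf⟩ := exists_surjective_nat ι
  set D : ℕ → Set M := disjointed fun k => U (f k)
  have hD (k) : MeasurableSet (D k) := .disjointed (fun k => hU (f k)) k
  have hDU (k) : D k ⊆ U (f k) := disjointed_subset _ k
  have hDcover : ⋃ k, D k = Set.univ := by rw [iUnion_disjointed, hf.iUnion_comp, hcover]
  refine ⟨Measure.sum fun k => (μ (f k)).restrict (D k), fun i A hA hAU => ?_⟩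
  calc Measure.sum (fun k => (μ (f k)).restrict (D k)) A
    _ = ∑' k, μ (f k) (A ∩ D k) := by
      simp only [Measure.sum_apply _ hA, Measure.restrict_apply hA]
    _ = ∑' k, μ i (A ∩ D k) := tsum_congr fun k =>
      hμ _ _ _ (hA.inter (hD k)) (Set.inter_subset_right.trans (hDU k))
        (Set.inter_subset_left.trans hAU)
    _ = μ i A := by
      rw [← measure_iUnion (fun k l hkl => (disjoint_disjointed _ hkl).mono
        Set.inter_subset_right Set.inter_subset_right) fun k => hA.inter (hD k),
        ← Set.inter_iUnion, hDcover, Set.inter_univ]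

lemma addHaar_basis_eq_smul {ι V : Type*} [Fintype ι] [DecidableEq ι] [NormedAddCommGroup V]
    [NormedSpace ℝ V] [MeasurableSpace V] [BorelSpace V] (b b' : Module.Basis ι ℝ V) :
    b'.addHaar = ENNReal.ofReal |b'.det b| • b.addHaar := by
  have : FiniteDimensional ℝ V := b.finiteDimensional_of_finite
  have hsmul := Measure.isAddLeftInvariant_eq_smul b'.addHaar b.addHaar
  have hvol := Measure.addHaar_parallelepiped b' b
  rw [hsmul, Measure.smul_apply, b.addHaar_self, ENNReal.smul_def, smul_eq_mul, mul_one] at hvol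
  rw [← hvol]
  exact hsmul

end MeasureGluing

section FormDensity

variable {n : ℕ} {V : Type*} [NormedAddCommGroup V] [NormedSpace ℝ V]
  {H : Type*} [TopologicalSpace H] {J : ModelWithCorners ℝ V H}
  {M : Type*} [TopologicalSpace M] [ChartedSpace H M]
  {H' : Type*} [TopologicalSpace H'] {J' : ModelWithCorners ℝ V H'}
  {N : Type*} [TopologicalSpace N] [ChartedSpace H' N]
  {Ω : (x : M) → TangentSpace J x [⋀^Fin n]→ₗ[ℝ] ℝ}
  {Ω' : (x : N) → TangentSpace J' x [⋀^Fin n]→ₗ[ℝ] ℝ}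

/-- The density of `|f^* Ω|` in the linear coordinates given by `b`, for a parametrization
`f : V → M`. -/
def formDensity (Ω : (x : M) → TangentSpace J x [⋀^Fin n]→ₗ[ℝ] ℝ) (f : V → M) (b : Fin n → V)
    (y : V) : ℝ≥0∞ :=
  ENNReal.ofReal |Ω (f y) (fun i => mfderiv 𝓘(ℝ, V) J f y (b i))|

/-- The map `F` satisfies `|F^* Ω'| = |Ω|`. -/
def PreservesAbsForm (Ω : (x : M) → TangentSpace J x [⋀^Fin n]→ₗ[ℝ] ℝ)
    (Ω' : (x : N) → TangentSpace J' x [⋀^Fin n]→ₗ[ℝ] ℝ) (F : M → N) : Prop :=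
  ∀ (x : M) (v : Fin n → TangentSpace J x), |Ω' (F x) (fun i => mfderiv J J' F x (v i))| = |Ω x v|

lemma preservesAbsForm_id (Ω : (x : M) → TangentSpace J x [⋀^Fin n]→ₗ[ℝ] ℝ) :
    PreservesAbsForm Ω Ω id := fun x v => by
  rw [mfderiv_id]; rfl

lemma formDensity_congr {f g : V → M} (b : Fin n → V) {y : V} (h : f =ᶠ[nhds y] g) :
    formDensity Ω f b y = formDensity Ω g b y := by
  unfold formDensity
  rw [h.mfderiv_eq]
  exact congrArg (fun z => ENNReal.ofReal |(Ω z : V [⋀^Fin n]→ₗ[ℝ] ℝ)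
    fun i => (mfderiv 𝓘(ℝ, V) J g y : V →L[ℝ] V) (b i)|) h.eq_of_nhds

lemma PreservesAbsForm.formDensity_comp {F : M → N} (hΩ : PreservesAbsForm Ω Ω' F) {f : V → M}
    (b : Fin n → V) {y : V} (hF : MDifferentiableAt J J' F (f y))
    (hf : MDifferentiableAt 𝓘(ℝ, V) J f y) :
    formDensity Ω' (F ∘ f) b y = formDensity Ω f b y := by
  unfold formDensity
  rw [mfderiv_comp y hF hf]
  exact congrArg ENNReal.ofReal (hΩ (f y) _)

lemma formDensity_comp_eq_abs_det_mul (b : Module.Basis (Fin n) ℝ V) {f : V → M} {T : V → V}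
    {y : V} (hf : MDifferentiableAt 𝓘(ℝ, V) J f (T y)) (hT : DifferentiableAt ℝ T y) :
    formDensity Ω (f ∘ T) b y =
      ENNReal.ofReal |(fderiv ℝ T y).det| * formDensity Ω f b (T y) := by
  unfold formDensity
  rw [mfderiv_comp y hf hT.mdifferentiableAt, mfderiv_eq_fderiv,
    ← ENNReal.ofReal_mul (abs_nonneg _), ← abs_mul]
  exact congrArg (fun r => ENNReal.ofReal |r|) <| alternatingMap_linearMap_comp b
    ((Ω (f (T y))).compLinearMap (mfderiv 𝓘(ℝ, V) J f (T y)).toLinearMap)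
    (fderiv ℝ T y).toLinearMap b

lemma formDensity_basis (f : V → M) (b b' : Module.Basis (Fin n) ℝ V) :
    formDensity Ω f b = ENNReal.ofReal |b'.det b| • formDensity Ω f b' := by
  ext y
  rw [Pi.smul_apply, smul_eq_mul]
  unfold formDensity
  rw [← ENNReal.ofReal_mul (abs_nonneg _), ← abs_mul, mul_comm]
  exact congrArg (fun a => ENNReal.ofReal |a b|) <| AlternatingMap.eq_smul_basis_det b'
    ((Ω (f y)).compLinearMap (mfderiv 𝓘(ℝ, V) J f y).toLinearMap)

lemma withDensity_formDensity_basis [MeasurableSpace V] [BorelSpace V] (f : V → M)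
    (b b' : Module.Basis (Fin n) ℝ V) :
    b.addHaar.withDensity (formDensity Ω f b) = b'.addHaar.withDensity (formDensity Ω f b') := by
  rw [addHaar_basis_eq_smul b b', withDensity_smul_measure,
    ← withDensity_smul' _ _ ENNReal.ofReal_ne_top, ← formDensity_basis]

end FormDensity

section ChartMeasure

variable {V : Type*} [NormedAddCommGroup V] [NormedSpace ℝ V]
  {H : Type*} [TopologicalSpace H] {J : ModelWithCorners ℝ V H}
  {M : Type*} [TopologicalSpace M]

lemma image_extend_eq_target_inter {φ : OpenPartialHomeomorph M H} {A : Set M}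
    (hA : A ⊆ φ.source) :
    φ.extend J '' A = (φ.extend J).target ∩ (φ.extend J).symm ⁻¹' A :=
  (φ.extend J).image_eq_target_inter_inv_preimage (by rwa [φ.extend_source])

lemma measurableSet_extend_image [J.Boundaryless] [MeasurableSpace V] [BorelSpace V]
    [MeasurableSpace M] [BorelSpace M] (φ : OpenPartialHomeomorph M H) {A : Set M}
    (hA : MeasurableSet A) (hAφ : A ⊆ φ.source) : MeasurableSet (φ.extend J '' A) := by
  have hcont := φ.continuousOn_extend_symm (I := J)
  rw [image_extend_eq_target_inter hAφ, ← Subtype.image_preimage_coe]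
  exact (φ.isOpen_extend_target (I := J)).measurableSet.subtype_image
    (hcont.domRestrict.measurable hA)

variable [ChartedSpace H M]

lemma mdifferentiableAt_extend [IsManifold J ∞ M] {φ : OpenPartialHomeomorph M H}
    (hφ : φ ∈ IsManifold.maximalAtlas J ∞ M) {x : M} (hx : x ∈ φ.source) :
    MDifferentiableAt J 𝓘(ℝ, V) (φ.extend J) x :=
  (φ.contMDiffAt_extend hφ hx).mdifferentiableAt (by simp)

section Definition

variable [MeasurableSpace V] [BorelSpace V] [MeasurableSpace M] {n : ℕ}

/-- The measure on the domain of the chart `φ` that has density `|Ω|` in this chart. -/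
def chartMeasure (Ω : (x : M) → TangentSpace J x [⋀^Fin n]→ₗ[ℝ] ℝ)
    (φ : OpenPartialHomeomorph M H) (b : Module.Basis (Fin n) ℝ V) : Measure M :=
  ((b.addHaar.withDensity (formDensity Ω (φ.extend J).symm b)).restrict
    (φ.extend J).target).map (φ.extend J).symm

lemma chartMeasure_basis (Ω : (x : M) → TangentSpace J x [⋀^Fin n]→ₗ[ℝ] ℝ)
    (φ : OpenPartialHomeomorph M H) (b b' : Module.Basis (Fin n) ℝ V) :
    chartMeasure Ω φ b = chartMeasure Ω φ b' := by
  rw [chartMeasure, withDensity_formDensity_basis _ b b', chartMeasure]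

end Definition

variable [J.Boundaryless]

lemma mdifferentiableAt_extend_symm [IsManifold J ∞ M] {φ : OpenPartialHomeomorph M H}
    (hφ : φ ∈ IsManifold.maximalAtlas J ∞ M) {y : V} (hy : y ∈ (φ.extend J).target) :
    MDifferentiableAt 𝓘(ℝ, V) J (φ.extend J).symm y := by
  have h := contMDiffOn_extend_symm hφ
  rw [← φ.extend_target'] at h
  exact (h.contMDiffAt ((φ.isOpen_extend_target).mem_nhds hy)).mdifferentiableAt (by simp)

variable [MeasurableSpace V] [BorelSpace V] [MeasurableSpace M] [BorelSpace M] {n : ℕ}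

lemma chartMeasure_apply (Ω : (x : M) → TangentSpace J x [⋀^Fin n]→ₗ[ℝ] ℝ)
    (φ : OpenPartialHomeomorph M H) (b : Module.Basis (Fin n) ℝ V) {A : Set M}
    (hA : MeasurableSet A) (hAφ : A ⊆ φ.source) :
    chartMeasure Ω φ b A =
      ∫⁻ y in φ.extend J '' A, formDensity Ω (φ.extend J).symm b y ∂b.addHaar := by
  have htarget := (φ.isOpen_extend_target (I := J)).measurableSet
  rw [chartMeasure, Measure.map_apply_of_aemeasurable
    (φ.continuousOn_extend_symm.aemeasurable htarget) hA, Measure.restrict_apply' htarget,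
    Set.inter_comm, ← image_extend_eq_target_inter hAφ,
    withDensity_apply _ (measurableSet_extend_image φ hA hAφ)]

lemma isFormMeasure_iff_chartMeasure {Ω : (x : M) → TangentSpace J x [⋀^Fin n]→ₗ[ℝ] ℝ}
    {ν : Measure M} : IsFormMeasure J Ω ν ↔
      ∀ φ ∈ IsManifold.maximalAtlas J ∞ M, ∀ b : Module.Basis (Fin n) ℝ V, ∀ A : Set M,
        MeasurableSet A → A ⊆ φ.source → ν A = chartMeasure Ω φ b A := by
  refine forall₂_congr fun φ _ => forall₂_congr fun b A => forall₂_congr fun hA hAφ => ?_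
  rw [chartMeasure_apply Ω φ b hA hAφ]
  rfl

end ChartMeasure

section ChangeOfVariables

variable {n : ℕ} {V : Type*} [NormedAddCommGroup V] [NormedSpace ℝ V]
  {H : Type*} [TopologicalSpace H] {J : ModelWithCorners ℝ V H} [J.Boundaryless]
  {M : Type*} [TopologicalSpace M] [ChartedSpace H M] [IsManifold J ∞ M]
  {H' : Type*} [TopologicalSpace H'] {J' : ModelWithCorners ℝ V H'}
  {N : Type*} [TopologicalSpace N] [ChartedSpace H' N] [IsManifold J' ∞ N]
  {Ω : (x : M) → TangentSpace J x [⋀^Fin n]→ₗ[ℝ] ℝ}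
  {Ω' : (x : N) → TangentSpace J' x [⋀^Fin n]→ₗ[ℝ] ℝ}
  {φ : OpenPartialHomeomorph M H} {ψ : OpenPartialHomeomorph N H'} {F : M → N}

lemma differentiableAt_extend_comp_extend_symm (hφ : φ ∈ IsManifold.maximalAtlas J ∞ M)
    (hψ : ψ ∈ IsManifold.maximalAtlas J' ∞ N) (hF : MDifferentiable J J' F) {y : V}
    (hy : y ∈ (φ.extend J).target) (hFy : F ((φ.extend J).symm y) ∈ ψ.source) :
    DifferentiableAt ℝ (ψ.extend J' ∘ F ∘ (φ.extend J).symm) y :=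
  ((mdifferentiableAt_extend hψ hFy).comp y
    ((hF _).comp y (mdifferentiableAt_extend_symm hφ hy))).differentiableAt

lemma PreservesAbsForm.formDensity_eq_abs_det_mul [J'.Boundaryless]
    (hΩ : PreservesAbsForm Ω Ω' F)
    (hφ : φ ∈ IsManifold.maximalAtlas J ∞ M) (hψ : ψ ∈ IsManifold.maximalAtlas J' ∞ N)
    (hF : MDifferentiable J J' F) (b : Module.Basis (Fin n) ℝ V) {y : V}
    (hy : y ∈ (φ.extend J).target) (hFy : F ((φ.extend J).symm y) ∈ ψ.source) :
    formDensity Ω (φ.extend J).symm b y =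
      ENNReal.ofReal |(fderiv ℝ (ψ.extend J' ∘ F ∘ (φ.extend J).symm) y).det| *
        formDensity Ω' (ψ.extend J').symm b ((ψ.extend J' ∘ F ∘ (φ.extend J).symm) y) := by
  have hsymm := mdifferentiableAt_extend_symm hφ hy
  have hFyψ : ψ.extend J' (F ((φ.extend J).symm y)) ∈ (ψ.extend J').target :=
    (ψ.extend J').map_source (by rwa [ψ.extend_source])
  have hnear : (ψ.extend J').symm ∘ ψ.extend J' ∘ F ∘ (φ.extend J).symm =ᶠ[nhds y]
      F ∘ (φ.extend J).symm := by
    have hcont : ContinuousAt (F ∘ (φ.extend J).symm) y :=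
      (hF.continuous.continuousAt).comp hsymm.continuousAt
    filter_upwards [hcont.preimage_mem_nhds (ψ.open_source.mem_nhds hFy)] with z hz
    exact ψ.extend_left_inv hz
  rw [← formDensity_comp_eq_abs_det_mul b (mdifferentiableAt_extend_symm hψ hFyψ)
    (differentiableAt_extend_comp_extend_symm hφ hψ hF hy hFy), formDensity_congr b hnear,
    hΩ.formDensity_comp b (hF _) hsymm]

variable [J'.Boundaryless] [MeasurableSpace V] [BorelSpace V] [MeasurableSpace M] [BorelSpace M]
  [MeasurableSpace N] [BorelSpace N]

theorem PreservesAbsForm.chartMeasure_image (hΩ : PreservesAbsForm Ω Ω' F)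
    (hφ : φ ∈ IsManifold.maximalAtlas J ∞ M) (hψ : ψ ∈ IsManifold.maximalAtlas J' ∞ N)
    (hF : MDifferentiable J J' F) (hinj : Function.Injective F) (b b' : Module.Basis (Fin n) ℝ V)
    {A : Set M} (hA : MeasurableSet A) (hFA : MeasurableSet (F '' A)) (hAφ : A ⊆ φ.source)
    (hFAψ : F '' A ⊆ ψ.source) :
    chartMeasure Ω' ψ b' (F '' A) = chartMeasure Ω φ b A := by
  have : FiniteDimensional ℝ V := b.finiteDimensional_of_finite
  rw [chartMeasure_basis Ω' ψ b' b, chartMeasure_apply Ω' ψ b hFA hFAψ,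
    chartMeasure_apply Ω φ b hA hAφ]
  set T : V → V := ψ.extend J' ∘ F ∘ (φ.extend J).symm
  have hTA : ∀ x ∈ A, T (φ.extend J x) = ψ.extend J' (F x) := fun x hx =>
    congrArg (fun z => ψ.extend J' (F z)) (φ.extend_left_inv (hAφ hx))
  have himage : ψ.extend J' '' (F '' A) = T '' (φ.extend J '' A) := by
    rw [Set.image_image, Set.image_image]
    exact Set.image_congr fun x hx => (hTA x hx).symm
  have htarget : ∀ y ∈ φ.extend J '' A,
      y ∈ (φ.extend J).target ∧ F ((φ.extend J).symm y) ∈ ψ.source := by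
    rw [image_extend_eq_target_inter hAφ]
    exact fun y hy => ⟨hy.1, hFAψ ⟨_, hy.2, rfl⟩⟩
  have hTinj : Set.InjOn T (φ.extend J '' A) := by
    rintro _ ⟨x, hx, rfl⟩ _ ⟨z, hz, rfl⟩ hxz
    rw [hTA x hx, hTA z hz] at hxz
    have hψinj := (ψ.extend J').injOn
    rw [ψ.extend_source] at hψinj
    rw [hinj (hψinj (hFAψ ⟨x, hx, rfl⟩) (hFAψ ⟨z, hz, rfl⟩) hxz)]
  rw [himage, lintegral_image_eq_lintegral_abs_det_fderiv_mul b.addHaar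
    (measurableSet_extend_image φ hA hAφ) (fun y hy => (differentiableAt_extend_comp_extend_symm
      hφ hψ hF (htarget y hy).1 (htarget y hy).2).hasFDerivAt.hasFDerivWithinAt) hTinj]
  exact setLIntegral_congr_fun (measurableSet_extend_image φ hA hAφ) fun y hy =>
    (hΩ.formDensity_eq_abs_det_mul hφ hψ hF b (htarget y hy).1 (htarget y hy).2).symm

end ChangeOfVariables

section FormMeasure

variable {n : ℕ} {V : Type*} [NormedAddCommGroup V] [NormedSpace ℝ V]
  [MeasurableSpace V] [BorelSpace V] {H : Type*} [TopologicalSpace H]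
  {J : ModelWithCorners ℝ V H} {M : Type*} [TopologicalSpace M]
  [SecondCountableTopology M] [ChartedSpace H M] [IsManifold J ∞ M] [MeasurableSpace M]
  [BorelSpace M]

theorem IsFormMeasure.unique {Ω : (x : M) → TangentSpace J x [⋀^Fin n]→ₗ[ℝ] ℝ}
    (b : Module.Basis (Fin n) ℝ V) {μ ν : Measure M} (hμ : IsFormMeasure J Ω μ)
    (hν : IsFormMeasure J Ω ν) : μ = ν := by
  refine measure_ext_of_nhds fun x => ⟨(chartAt H x).source, (chartAt H x).open_source,
    mem_chart_source H x, fun A hA hAx => ?_⟩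
  have hx := IsManifold.chart_mem_maximalAtlas (I := J) (n := ∞) x
  rw [hμ _ hx b A hA hAx, hν _ hx b A hA hAx]

variable [J.Boundaryless]

theorem exists_isFormMeasure (Ω : (x : M) → TangentSpace J x [⋀^Fin n]→ₗ[ℝ] ℝ)
    (b : Module.Basis (Fin n) ℝ V) : ∃ ν : Measure M, IsFormMeasure J Ω ν := by
  have heq {φ ψ : OpenPartialHomeomorph M H} (hφ : φ ∈ IsManifold.maximalAtlas J ∞ M)
      (hψ : ψ ∈ IsManifold.maximalAtlas J ∞ M) (b b' : Module.Basis (Fin n) ℝ V) {A : Set M}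
      (hA : MeasurableSet A) (hAφ : A ⊆ φ.source) (hAψ : A ⊆ ψ.source) :
      chartMeasure Ω φ b A = chartMeasure Ω ψ b' A := by
    have h := (preservesAbsForm_id Ω).chartMeasure_image hψ hφ mdifferentiable_id
      Function.injective_id b' b hA (by rwa [Set.image_id]) hAψ (by rwa [Set.image_id])
    rwa [Set.image_id] at h
  have hchart (x : M) := IsManifold.chart_mem_maximalAtlas (I := J) (n := ∞) x
  obtain ⟨s, hs, hsU⟩ := TopologicalSpace.countable_cover_nhds (chart_source_mem_nhds H (M := M))
  have : Countable s := hs.to_subtype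
  rw [Set.biUnion_eq_iUnion] at hsU
  obtain ⟨ν, hν⟩ := exists_measure_of_forall_eq_on_inter
    (fun x : s => (chartAt H x.1).open_source.measurableSet) hsU
    (μ := fun x => chartMeasure Ω (chartAt H x.1) b)
    fun x y A hA => heq (hchart x) (hchart y) b b hA
  refine ⟨ν, isFormMeasure_iff_chartMeasure.2 fun ψ hψ b' A hA hAψ => ?_⟩
  have hrestrict : ν.restrict ψ.source = (chartMeasure Ω ψ b').restrict ψ.source := by
    refine Measure.ext_of_iUnion_eq_univ hsU fun x => Measure.ext fun B hB => ?_
    have hsource := (chartAt H x.1).open_source.measurableSet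
    simp only [Measure.restrict_apply hB,
      Measure.restrict_apply (hB.inter hsource)]
    have hBx := (hB.inter hsource).inter ψ.open_source.measurableSet
    rw [hν x _ hBx (Set.inter_subset_left.trans Set.inter_subset_right)]
    exact heq (hchart x) hψ b b' hBx (Set.inter_subset_left.trans Set.inter_subset_right)
      Set.inter_subset_right
  have happly := congrArg (· A) hrestrict
  simpa only [Measure.restrict_apply hA, Set.inter_eq_left.2 hAψ] using happly

theorem IsFormMeasure.map_homeomorph_symm {Ω : (x : M) → TangentSpace J x [⋀^Fin n]→ₗ[ℝ] ℝ}
    (b : Module.Basis (Fin n) ℝ V) {ν : Measure M} (hν : IsFormMeasure J Ω ν) (F : M ≃ₜ M)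
    (hF : MDifferentiable J J F) (hΩ : PreservesAbsForm Ω Ω F) : ν.map F.symm = ν := by
  refine measure_ext_of_nhds fun x => ⟨(chartAt H x).source ∩ F ⁻¹' (chartAt H (F x)).source,
    (chartAt H x).open_source.inter ((chartAt H (F x)).open_source.preimage F.continuous),
    ⟨mem_chart_source H x, mem_chart_source H (F x)⟩, fun A hA hAx => ?_⟩
  have hx := IsManifold.chart_mem_maximalAtlas (I := J) (n := ∞) x
  have hFx := IsManifold.chart_mem_maximalAtlas (I := J) (n := ∞) (F x)
  have hFA : MeasurableSet (F '' A) := F.toMeasurableEquiv.measurableSet_image.2 hA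
  have hAx' : A ⊆ (chartAt H x).source := hAx.trans Set.inter_subset_left
  have hFAx : F '' A ⊆ (chartAt H (F x)).source :=
    Set.image_subset_iff.2 (hAx.trans Set.inter_subset_right)
  rw [isFormMeasure_iff_chartMeasure] at hν
  rw [Measure.map_apply F.symm.continuous.measurable hA, ← F.image_eq_preimage_symm,
    hν _ hx b A hA hAx', hν _ hFx b _ hFA hFAx]
  exact hΩ.chartMeasure_image hx hFx hF F.injective b b hA hFA hAx' hFAx

end FormMeasure

/-! ### Invariant forms on Lie groups -/

section LocallyFinite

lemma exists_isCompact_mem_nhds_setLIntegral_ne_zero_ne_top {V : Type*} [TopologicalSpace V]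
    [LocallyCompactSpace V] [T2Space V] [MeasurableSpace V] [BorelSpace V] (μ : Measure V)
    [IsFiniteMeasureOnCompacts μ] [μ.IsOpenPosMeasure] {d : V → ℝ≥0∞} {y : V} {U : Set V}
    (hU : U ∈ nhds y) (hd : ContinuousAt d y) (h0 : d y ≠ 0) (htop : d y ≠ ⊤) :
    ∃ C ∈ nhds y, IsCompact C ∧ C ⊆ U ∧ ∫⁻ z in C, d z ∂μ ≠ 0 ∧ ∫⁻ z in C, d z ∂μ ≠ ⊤ := by
  have hnear : ∀ᶠ z in nhds y, d z ∈ Set.Ioo (d y / 2) (d y + 1) :=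
    hd.eventually_mem (Ioo_mem_nhds (ENNReal.half_lt_self h0 htop)
      (ENNReal.lt_add_right htop one_ne_zero))
  obtain ⟨C, hC, hCU, hCc⟩ := local_compact_nhds (Filter.inter_mem hnear hU)
  refine ⟨C, hC, hCc, hCU.trans Set.inter_subset_right, ne_of_gt ?_, ne_of_lt ?_⟩
  · calc 0
      _ < d y / 2 * μ C :=
        ENNReal.mul_pos (ENNReal.half_pos h0).ne' (Measure.measure_pos_of_mem_nhds μ hC).ne'
      _ = ∫⁻ _ in C, d y / 2 ∂μ := (setLIntegral_const C _).symm
      _ ≤ ∫⁻ z in C, d z ∂μ :=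
        setLIntegral_mono' hCc.measurableSet fun z hz => (hCU hz).1.1.le
  · calc ∫⁻ z in C, d z ∂μ
      _ ≤ ∫⁻ _ in C, (d y + 1) ∂μ :=
        setLIntegral_mono' hCc.measurableSet fun z hz => (hCU hz).1.2.le
      _ = (d y + 1) * μ C := setLIntegral_const C _
      _ < ⊤ := ENNReal.mul_lt_top (by simpa using htop.lt_top) hCc.measure_lt_top

variable {n : ℕ} {V : Type*} [NormedAddCommGroup V] [NormedSpace ℝ V]
  [MeasurableSpace V] [BorelSpace V] {H : Type*} [TopologicalSpace H]
  {J : ModelWithCorners ℝ V H} [J.Boundaryless] {M : Type*} [TopologicalSpace M]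
  [ChartedSpace H M] [IsManifold J ∞ M]

lemma IsFormMeasure.exists_isCompact_mem_nhds [T2Space M] [MeasurableSpace M] [BorelSpace M]
    {Ω : (x : M) → TangentSpace J x [⋀^Fin n]→ₗ[ℝ] ℝ} (b : Module.Basis (Fin n) ℝ V)
    {ν : Measure M} (hν : IsFormMeasure J Ω ν) {x : M}
    (hd : ContinuousAt (formDensity Ω (extChartAt J x).symm b) (extChartAt J x x))
    (h0 : formDensity Ω (extChartAt J x).symm b (extChartAt J x x) ≠ 0) :
    ∃ K ∈ nhds x, IsCompact K ∧ ν K ≠ 0 ∧ ν K ≠ ⊤ := by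
  have : FiniteDimensional ℝ V := b.finiteDimensional_of_finite
  have : ProperSpace V := FiniteDimensional.proper_real V
  obtain ⟨C, hCx, hC, hCtarget, hpos, hfin⟩ :=
    exists_isCompact_mem_nhds_setLIntegral_ne_zero_ne_top b.addHaar
      (extChartAt_target_mem_nhds x) hd h0 ENNReal.ofReal_ne_top
  have hKcompact : IsCompact ((extChartAt J x).symm '' C) :=
    hC.image_of_continuousOn ((continuousOn_extChartAt_symm x).mono hCtarget)
  have hKsource : (extChartAt J x).symm '' C ⊆ (chartAt H x).source := by
    rw [← extChartAt_source J]
    exact ((extChartAt J x).mapsTo_symm.mono_left hCtarget).image_subset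
  have hKC : extChartAt J x '' ((extChartAt J x).symm '' C) = C := by
    rw [Set.image_image]
    exact (Set.image_congr fun y hy => (extChartAt J x).right_inv (hCtarget hy)).trans
      (Set.image_id' C)
  have hνK : ν ((extChartAt J x).symm '' C) =
      ∫⁻ y in C, formDensity Ω (extChartAt J x).symm b y ∂b.addHaar := by
    conv_rhs => rw [← hKC]
    exact hν _ (IsManifold.chart_mem_maximalAtlas x) b _ hKcompact.measurableSet hKsource
  refine ⟨_, ?_, hKcompact, hνK ▸ hpos, hνK ▸ hfin⟩
  filter_upwards [extChartAt_source_mem_nhds (I := J) x,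
    (continuousAt_extChartAt x).preimage_mem_nhds hCx] with z hz hzC
  exact ⟨_, hzC, (extChartAt J x).left_inv hz⟩

end LocallyFinite

section LieGroup

variable {n : ℕ} {V : Type*} [NormedAddCommGroup V] [NormedSpace ℝ V]
  {H : Type*} [TopologicalSpace H] {J : ModelWithCorners ℝ V H}

lemma formDensity_extChartAt_self_ne_zero [J.Boundaryless] {M : Type*} [TopologicalSpace M]
    [ChartedSpace H M] [IsManifold J ∞ M] {Ω : (x : M) → TangentSpace J x [⋀^Fin n]→ₗ[ℝ] ℝ}
    (b : Module.Basis (Fin n) ℝ V) {x : M} (hΩ : Ω x ≠ 0) :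
    formDensity Ω (extChartAt J x).symm b (extChartAt J x x) ≠ 0 := by
  have : IsManifold J 1 M := .of_le (n := ∞) (by simp)
  have hmfderiv : mfderiv 𝓘(ℝ, V) J (extChartAt J x).symm (extChartAt J x x) =
      ContinuousLinearMap.id ℝ V := by
    rw [← mfderivWithin_univ, ← J.range_eq_univ]
    exact mfderivWithin_range_extChartAt_symm
  unfold formDensity
  rw [hmfderiv, extChartAt_to_inv]
  exact (ENNReal.ofReal_pos.2 (abs_pos.2 ((AlternatingMap.map_basis_ne_zero_iff b _).2 hΩ))).ne'

/-- Left division by the point with coordinates `y`, read in the chart at `1`. -/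
def chartLeftDiv (J : ModelWithCorners ℝ V H) (K : Type*) [TopologicalSpace K] [ChartedSpace H K]
    [Group K] (y : V) : V → V :=
  extChartAt J (1 : K) ∘ (((extChartAt J (1 : K)).symm y)⁻¹ * ·) ∘ (extChartAt J (1 : K)).symm

variable {K : Type*} [TopologicalSpace K] [ChartedSpace H K] [Group K]

lemma chartLeftDiv_self (y : V) : chartLeftDiv J K y y = extChartAt J (1 : K) 1 :=
  congrArg (extChartAt J (1 : K)) (inv_mul_cancel _)

variable [J.Boundaryless] [LieGroup J ∞ K] {Ω : (x : K) → TangentSpace J x [⋀^Fin n]→ₗ[ℝ] ℝ}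

lemma contDiffAt_uncurry_chartLeftDiv :
    ContDiffAt ℝ ∞ (Function.uncurry (chartLeftDiv J K))
      (extChartAt J (1 : K) 1, extChartAt J (1 : K) 1) := by
  have hsymm : ContMDiffAt 𝓘(ℝ, V) J ∞ (extChartAt J (1 : K)).symm (extChartAt J (1 : K) 1) :=
    (contMDiffOn_extChartAt_symm 1).contMDiffAt (extChartAt_target_mem_nhds 1)
  have hdiv : ContMDiffAt 𝓘(ℝ, V × V) J ∞
      (fun p : V × V => ((extChartAt J (1 : K)).symm p.1)⁻¹ * (extChartAt J (1 : K)).symm p.2)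
      (extChartAt J (1 : K) 1, extChartAt J (1 : K) 1) :=
    ((hsymm.comp (extChartAt J (1 : K) 1, extChartAt J (1 : K) 1)
      contDiffAt_fst.contMDiffAt).inv).mul (hsymm.comp (extChartAt J (1 : K) 1,
      extChartAt J (1 : K) 1) contDiffAt_snd.contMDiffAt)
  have hchart : ContMDiffAt J 𝓘(ℝ, V) ∞ (extChartAt J (1 : K)) 1 := contMDiffAt_extChartAt
  exact (ContMDiffAt.comp_of_eq (g := extChartAt J (1 : K)) hchart hdiv
    (inv_mul_cancel _)).contDiffAt

lemma formDensity_extChartAt_one_eq_abs_det_mul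
    (hΩ : ∀ g : K, PreservesAbsForm Ω Ω (g * ·)) (b : Module.Basis (Fin n) ℝ V) {y : V}
    (hy : y ∈ (extChartAt J (1 : K)).target) :
    formDensity Ω (extChartAt J (1 : K)).symm b y =
      ENNReal.ofReal |(fderiv ℝ (chartLeftDiv J K y) y).det| *
        formDensity Ω (extChartAt J (1 : K)).symm b (extChartAt J (1 : K) 1) := by
  have h := (hΩ ((extChartAt J (1 : K)).symm y)⁻¹).formDensity_eq_abs_det_mul
    (IsManifold.chart_mem_maximalAtlas 1) (IsManifold.chart_mem_maximalAtlas 1)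
    ((contMDiff_mul_left (I := J) (n := ∞)).mdifferentiable (by simp)) b hy
    ((inv_mul_cancel ((extChartAt J (1 : K)).symm y)).symm ▸ mem_chart_source H 1)
  rw [← chartLeftDiv_self (J := J) (K := K) y]
  exact h

theorem continuousAt_formDensity_extChartAt_one
    (hΩ : ∀ g : K, PreservesAbsForm Ω Ω (g * ·)) (b : Module.Basis (Fin n) ℝ V) :
    ContinuousAt (formDensity Ω (extChartAt J (1 : K)).symm b) (extChartAt J (1 : K) 1) := by
  have hfderiv : ContinuousAt (fun y => fderiv ℝ (chartLeftDiv J K y) y)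
      (extChartAt J (1 : K) 1) :=
    (contDiffAt_uncurry_chartLeftDiv.fderiv (m := 0) contDiffAt_id (by simp)).continuousAt
  have hmul : ContinuousAt (fun y => ENNReal.ofReal |(fderiv ℝ (chartLeftDiv J K y) y).det| *
      formDensity Ω (extChartAt J (1 : K)).symm b (extChartAt J (1 : K) 1))
      (extChartAt J (1 : K) 1) :=
    ENNReal.Tendsto.mul_const (ENNReal.continuous_ofReal.continuousAt.comp
      (ContinuousLinearMap.continuous_det.continuousAt.comp hfderiv).abs)
      (Or.inr ENNReal.ofReal_ne_top)
  refine hmul.congr ?_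
  filter_upwards [extChartAt_target_mem_nhds (I := J) (1 : K)] with y hy
  exact (formDensity_extChartAt_one_eq_abs_det_mul hΩ b hy).symm

theorem IsFormMeasure.isHaarMeasure [T2Space K] [SecondCountableTopology K] [IsTopologicalGroup K]
    [MeasurableSpace K] [BorelSpace K] [MeasurableSpace V] [BorelSpace V]
    (b : Module.Basis (Fin n) ℝ V) {ν : Measure K} (hν : IsFormMeasure J Ω ν)
    (hΩ : ∀ g : K, PreservesAbsForm Ω Ω (g * ·)) (h0 : Ω 1 ≠ 0) : ν.IsHaarMeasure := by
  have : ν.IsMulLeftInvariant := ⟨fun g => by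
    have h := hν.map_homeomorph_symm b (Homeomorph.mulLeft g⁻¹)
      ((contMDiff_mul_left (I := J) (n := ∞)).mdifferentiable (by simp)) (hΩ g⁻¹)
    rwa [Homeomorph.mulLeft_symm, inv_inv] at h⟩
  obtain ⟨C, hC, hCc, hCpos, hCfin⟩ := hν.exists_isCompact_mem_nhds b
    (continuousAt_formDensity_extChartAt_one hΩ b) (formDensity_extChartAt_self_ne_zero b h0)
  exact Measure.isHaarMeasure_of_isCompact_nonempty_interior ν C hCc
    ⟨1, mem_interior_iff_mem_nhds.2 hC⟩ hCpos hCfin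

end LieGroup

/-! ### The Lie group `G × 𝔤` -/

section ProdAddGroup

/-- The product of a multiplicative and an additive group, written multiplicatively. It turns
`G × 𝔤` into a Lie group, so that uniqueness of Haar measure applies to it. -/
abbrev prodAddGroup (G E : Type*) [Group G] [AddGroup E] : Group (G × E) where
  mul p q := (p.1 * q.1, p.2 + q.2)
  one := (1, 0)
  inv p := (p.1⁻¹, -p.2)
  mul_assoc _ _ _ := Prod.ext (mul_assoc _ _ _) (add_assoc _ _ _)
  one_mul _ := Prod.ext (one_mul _) (zero_add _)
  mul_one _ := Prod.ext (mul_one _) (add_zero _)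
  inv_mul_cancel _ := Prod.ext (inv_mul_cancel _) (neg_add_cancel _)

attribute [local instance] prodAddGroup

theorem isHaarMeasure_prodAddGroup {G E : Type*} [Group G] [TopologicalSpace G]
    [MeasurableSpace G] [MeasurableMul G] [AddGroup E] [TopologicalSpace E] [MeasurableSpace E]
    [MeasurableAdd E] (haar : Measure G) [haar.IsHaarMeasure] [SFinite haar] (leb : Measure E)
    [leb.IsAddHaarMeasure] [SFinite leb] : (haar.prod leb).IsHaarMeasure where
  map_mul_left_eq_self g :=
    calc (haar.prod leb).map (Prod.map (g.1 * ·) (g.2 + ·))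
      _ = (haar.map (g.1 * ·)).prod (leb.map (g.2 + ·)) :=
        (Measure.map_prod_map haar leb (measurable_const_mul _) (measurable_const_add _)).symm
      _ = haar.prod leb := by rw [map_mul_left_eq_self, map_add_left_eq_self]
  lt_top_of_isCompact _ hK := hK.measure_lt_top
  open_pos _ hU hne := hU.measure_ne_zero _ hne

theorem lieGroup_prodAddGroup {V H G E : Type*} [NormedAddCommGroup V] [NormedSpace ℝ V]
    [TopologicalSpace H] (I : ModelWithCorners ℝ V H) [TopologicalSpace G] [ChartedSpace H G]
    [Group G] [LieGroup I ∞ G] [NormedAddCommGroup E] [NormedSpace ℝ E] :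
    LieGroup (I.prod 𝓘(ℝ, E)) ∞ (G × E) where
  contMDiff_mul := (contMDiff_fst.fst.mul contMDiff_snd.fst).prodMk
    (contMDiff_fst.snd.add contMDiff_snd.snd)
  contMDiff_inv := contMDiff_fst.inv.prodMk contMDiff_snd.neg

end ProdAddGroup

section Symplectic

variable {m : ℕ} {G : Type*} [TopologicalSpace G] [ChartedSpace (EuclideanSpace ℝ (Fin m)) G]
  [Group G]

lemma finrank_groupLieAlgebra : Module.finrank ℝ (GroupLieAlgebra (𝓡 m) G) = m :=
  finrank_euclideanSpace_fin

/-- A basis of the model space of `G × 𝔤`, indexed as `IsFormMeasure` requires for `ω^m`. -/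
def productModelBasis (m : ℕ) (G : Type*) [TopologicalSpace G]
    [ChartedSpace (EuclideanSpace ℝ (Fin m)) G] [Group G] :
    Module.Basis (Fin (2 * m)) ℝ (EuclideanSpace ℝ (Fin m) × GroupLieAlgebra (𝓡 m) G) :=
  Module.finBasisOfFinrankEq ℝ _ <| by
    rw [Module.finrank_prod, finrank_euclideanSpace_fin, finrank_groupLieAlgebra, two_mul]

lemma leftTriv_one_apply (v : TangentSpace (𝓡 m) (1 : G)) : leftTriv (1 : G) v = v := by
  have hid : ((1 : G)⁻¹ * ·) = id := by simp only [inv_one, one_mul]; rfl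
  unfold leftTriv
  rw [hid, mfderiv_id]
  rfl

variable [LieGroup (𝓡 m) ∞ G]

lemma mdifferentiable_mul_left (g : G) : MDifferentiable (𝓡 m) (𝓡 m) (g * ·) :=
  (contMDiff_mul_left (I := 𝓡 m) (n := ∞)).mdifferentiable (by simp)

lemma leftTriv_mul_mfderiv (g h : G) (v : TangentSpace (𝓡 m) h) :
    leftTriv (g * h) (mfderiv (𝓡 m) (𝓡 m) (g * ·) h v) = leftTriv h v := by
  have hcomp : ((g * h)⁻¹ * ·) ∘ (g * ·) = (h⁻¹ * · : G → G) := by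
    funext x
    simp only [Function.comp_apply, mul_inv_rev, mul_assoc, inv_mul_cancel_left]
  have hchain := mfderiv_comp_apply h (mdifferentiable_mul_left (g * h)⁻¹ (g * h))
    (mdifferentiable_mul_left g h) v
  rw [hcomp] at hchain
  exact hchain.symm

attribute [local instance] prodAddGroup

lemma leftTrivProd_mul_mfderiv (p q : G × GroupLieAlgebra (𝓡 m) G)
    (v : TangentSpace ((𝓡 m).prod 𝓘(ℝ, GroupLieAlgebra (𝓡 m) G)) q) :
    leftTrivProd (p * q) (mfderiv ((𝓡 m).prod 𝓘(ℝ, GroupLieAlgebra (𝓡 m) G))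
      ((𝓡 m).prod 𝓘(ℝ, GroupLieAlgebra (𝓡 m) G)) (p * ·) q v) = leftTrivProd q v := by
  have hadd : HasMFDerivAt 𝓘(ℝ, GroupLieAlgebra (𝓡 m) G) 𝓘(ℝ, GroupLieAlgebra (𝓡 m) G)
      (p.2 + ·) q.2 (ContinuousLinearMap.id ℝ (GroupLieAlgebra (𝓡 m) G)) :=
    ((hasFDerivAt_id q.2).const_add p.2).hasMFDerivAt
  have hmul :=
    ((mdifferentiable_mul_left (m := m) p.1 q.1).hasMFDerivAt.prodMap (p := q) hadd).mfderiv
  refine (congrArg (leftTrivProd (p * q)) (DFunLike.congr_fun hmul v)).trans ?_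
  exact Prod.ext (leftTriv_mul_mfderiv p.1 q.1 v.1) (DFunLike.congr_fun hadd.mfderiv v.2)

theorem abs_wedgePow_symplecticForm (ip : InnerProductSpace.Core ℝ (GroupLieAlgebra (𝓡 m) G))
    (p : G × GroupLieAlgebra (𝓡 m) G)
    (v : Fin (2 * m) → TangentSpace ((𝓡 m).prod 𝓘(ℝ, GroupLieAlgebra (𝓡 m) G)) p) :
    |wedgePow (symplecticForm ip p) m v| =
      |wedgePow (trivializedForm ip 0) m fun i => leftTrivProd p (v i)| := by
  unfold symplecticForm
  rw [wedgePow_compLinearMap]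
  exact abs_wedgePow_trivializedForm ip p.2 finrank_groupLieAlgebra _

theorem preservesAbsForm_mul_left_wedgePow_symplecticForm
    (ip : InnerProductSpace.Core ℝ (GroupLieAlgebra (𝓡 m) G))
    (p : G × GroupLieAlgebra (𝓡 m) G) :
    PreservesAbsForm (J := (𝓡 m).prod 𝓘(ℝ, GroupLieAlgebra (𝓡 m) G))
      (J' := (𝓡 m).prod 𝓘(ℝ, GroupLieAlgebra (𝓡 m) G))
      (fun q => wedgePow (symplecticForm ip q) m) (fun q => wedgePow (symplecticForm ip q) m)
      (p * ·) := fun q v => by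
  rw [abs_wedgePow_symplecticForm, abs_wedgePow_symplecticForm]
  simp only [leftTrivProd_mul_mfderiv]

lemma wedgePow_symplecticForm_one_ne_zero
    (ip : InnerProductSpace.Core ℝ (GroupLieAlgebra (𝓡 m) G)) :
    wedgePow (symplecticForm ip (1 : G × GroupLieAlgebra (𝓡 m) G)) m ≠ 0 := by
  have h : leftTrivProd (1 : G × GroupLieAlgebra (𝓡 m) G) = LinearMap.id :=
    LinearMap.ext fun v => Prod.ext (leftTriv_one_apply v.1) rfl
  unfold symplecticForm
  rw [h]
  exact wedgePow_trivializedForm_ne_zero ip finrank_groupLieAlgebra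

theorem IsFormMeasure.isHaarMeasure_symplectic [T2Space G] [SecondCountableTopology G]
    [MeasurableSpace G] [BorelSpace G]
    {ip : InnerProductSpace.Core ℝ (GroupLieAlgebra (𝓡 m) G)}
    {ν : Measure (G × GroupLieAlgebra (𝓡 m) G)}
    (hν : IsFormMeasure ((𝓡 m).prod 𝓘(ℝ, GroupLieAlgebra (𝓡 m) G))
      (fun p => wedgePow (symplecticForm ip p) m) ν) : ν.IsHaarMeasure := by
  have := lieGroup_prodAddGroup (𝓡 m) (G := G) (E := GroupLieAlgebra (𝓡 m) G)
  have := topologicalGroup_of_lieGroup ((𝓡 m).prod 𝓘(ℝ, GroupLieAlgebra (𝓡 m) G)) ∞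
    (G := G × GroupLieAlgebra (𝓡 m) G)
  exact hν.isHaarMeasure (productModelBasis m G)
    (preservesAbsForm_mul_left_wedgePow_symplecticForm ip)
    (wedgePow_symplecticForm_one_ne_zero ip)

theorem IsFormMeasure.exists_prod_eq_smul [T2Space G] [SecondCountableTopology G]
    [MeasurableSpace G] [BorelSpace G]
    {ip : InnerProductSpace.Core ℝ (GroupLieAlgebra (𝓡 m) G)}
    {ν : Measure (G × GroupLieAlgebra (𝓡 m) G)}
    (hν : IsFormMeasure ((𝓡 m).prod 𝓘(ℝ, GroupLieAlgebra (𝓡 m) G))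
      (fun p => wedgePow (symplecticForm ip p) m) ν)
    (haar : Measure G) [haar.IsHaarMeasure]
    (leb : Measure (GroupLieAlgebra (𝓡 m) G)) [leb.IsAddHaarMeasure] :
    ∃ c : ℝ≥0, 0 < c ∧ haar.prod leb = c • ν := by
  have := topologicalGroup_of_lieGroup (𝓡 m) ∞ (G := G)
  have := ChartedSpace.locallyCompactSpace (EuclideanSpace ℝ (Fin m)) G
  have := lieGroup_prodAddGroup (𝓡 m) (G := G) (E := GroupLieAlgebra (𝓡 m) G)
  have := topologicalGroup_of_lieGroup ((𝓡 m).prod 𝓘(ℝ, GroupLieAlgebra (𝓡 m) G)) ∞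
    (G := G × GroupLieAlgebra (𝓡 m) G)
  have := isHaarMeasure_prodAddGroup haar leb
  have := hν.isHaarMeasure_symplectic
  exact ⟨_, Measure.haarScalarFactor_pos_of_isHaarMeasure _ _,
    Measure.isMulLeftInvariant_eq_smul (haar.prod leb) ν⟩

end Symplectic

end LieVolume

end

theorem mainTheorem8 {m : ℕ} {G : Type*} [TopologicalSpace G] [T2Space G]
    [SecondCountableTopology G] [ChartedSpace (EuclideanSpace ℝ (Fin m)) G] [Group G]
    [LieGroup (𝓡 m) ∞ G] [MeasurableSpace G] [BorelSpace G]
    (ip : InnerProductSpace.Core ℝ (GroupLieAlgebra (𝓡 m) G))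
    (haar : Measure G) [haar.IsHaarMeasure]
    (leb : Measure (GroupLieAlgebra (𝓡 m) G)) [leb.IsAddHaarMeasure] :
    (∃! ν : Measure (G × GroupLieAlgebra (𝓡 m) G),
      LieVolume.IsFormMeasure ((𝓡 m).prod 𝓘(ℝ, GroupLieAlgebra (𝓡 m) G))
        (fun p => LieVolume.wedgePow (LieVolume.symplecticForm ip p) m) ν) ∧
    ∃ c : ℝ≥0, 0 < c ∧ ∀ ν : Measure (G × GroupLieAlgebra (𝓡 m) G),
      LieVolume.IsFormMeasure ((𝓡 m).prod 𝓘(ℝ, GroupLieAlgebra (𝓡 m) G))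
        (fun p => LieVolume.wedgePow (LieVolume.symplecticForm ip p) m) ν →
      haar.prod leb = c • ν := by
  obtain ⟨ν, hν⟩ := LieVolume.exists_isFormMeasure (J := (𝓡 m).prod 𝓘(ℝ, GroupLieAlgebra (𝓡 m) G))
    (fun p : G × GroupLieAlgebra (𝓡 m) G => LieVolume.wedgePow (LieVolume.symplecticForm ip p) m)
    (LieVolume.productModelBasis m G)
  have hunique (ν' : Measure (G × GroupLieAlgebra (𝓡 m) G))
      (hν' : LieVolume.IsFormMeasure ((𝓡 m).prod 𝓘(ℝ, GroupLieAlgebra (𝓡 m) G))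
        (fun p => LieVolume.wedgePow (LieVolume.symplecticForm ip p) m) ν') : ν' = ν :=
    hν'.unique (LieVolume.productModelBasis m G) hν
  obtain ⟨c, hc, hcν⟩ := hν.exists_prod_eq_smul haar leb
  exact ⟨⟨ν, hν, hunique⟩, c, hc, fun ν' hν' => by rw [hunique ν' hν', hcν]⟩
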